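/- For a nonempty set $S\subseteq\mathbb{Z}^n$, say that $S$ is *L$^\natural$-convex* if for all $x,y\in S$ the vectors $\lceil (x+y)/2\rceil$ and $\lfloor (x+y)/2\rfloor$ (componentwise rounding) belong to $S$. For positive integers $n,k$ put $$\alpha(n,k)=\Bigl(1-\frac1n\Bigr)\min(n,k),\qquad \beta(n,k)=\frac12\sqrt{n\cdot\min(n,k)}.$$ **Theorem.** Let $n\ge 2$ and $m\ge 1$, let $S_1,\dots,S_m\subseteq\mathbb{Z}^n$ be L$^\natural$-convex sets, let $W=S_1+\cdots+S_m=\{s_1+\cdots+s_m : s_i\in S_i\}$ be their Minkowski sum, and let $x\in\mathbb{R}^n$ belong to the convex hull of $W$. Then: 1. There exists $z\in W$ with $\|x-z\|_\infty\le\alpha(n,\lceil m/2\rceil)$ and such that, if $x\in\mathbb{Z}^n$, then $\|x-z\|_\infty\le\lfloor\alpha(n,\lceil m/2\rceil)\rfloor$. Moreover $\lfloor\alpha(n,\lceil m/2\rceil)\rfloor=\min(n,\lceil m/2\rceil)-1$. 2. There exists $z\in W$ with $\|x-z\|_2\le\beta(n,\lceil m/2\rceil)$ and such that, if $x\in\mathbb{Z}^n$,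 then $\|x-z\|_\infty\le\lfloor\beta(n,\lceil m/2\rceil)\rfloor$. 3. There exists $z\in W$ with $\|x-z\|_\infty\le\min\{\alpha(n,\lceil m/2\rceil),\beta(n,\lceil m/2\rceil)\}$ and such that, if $x\in\mathbb{Z}^n$, then $\|x-z\|_\infty\le\min\{\lfloor\alpha(n,\lceil m/2\rceil)\rfloor,\lfloor\beta(n,\lceil m/2\rceil)\rfloor\}$. -/

import Mathlib

open scoped Pointwise

noncomputable section

namespace ShapleyFolkman

/-- The inclusion of `ℤⁿ` into `ℝⁿ`. The norm on `Fin n → ℝ` is the maximum norm. -/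
def toReal {n : ℕ} (z : Fin n → ℤ) : Fin n → ℝ := fun i => (z i : ℝ)

/-- The convex hull in `ℝⁿ` of a set of integer vectors. -/
def hull {n : ℕ} (S : Set (Fin n → ℤ)) : Set (Fin n → ℝ) := convexHull ℝ (toReal '' S)

/-- The Euclidean norm of a vector of `ℝⁿ`. -/
def norm2 {n : ℕ} (x : Fin n → ℝ) : ℝ := ‖WithLp.toLp 2 x‖

/-- `x ∈ ℝⁿ` is an integer vector. -/
def IsIntegral {n : ℕ} (x : Fin n → ℝ) : Prop := ∃ w : Fin n → ℤ, x = toReal w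

/-- L♮-convex sets: nonempty sets of integer vectors with discrete midpoint convexity. -/
def IsLNatConvex {n : ℕ} (S : Set (Fin n → ℤ)) : Prop :=
  S.Nonempty ∧ ∀ x ∈ S, ∀ y ∈ S,
    (fun i => ⌈((x i : ℝ) + (y i : ℝ)) / 2⌉) ∈ S ∧
    (fun i => ⌊((x i : ℝ) + (y i : ℝ)) / 2⌋) ∈ S

/-- `α(n, k) = (1 - 1/n) min(n, k)`. -/
def alpha (n k : ℕ) : ℝ := (1 - 1 / (n : ℝ)) * min (n : ℝ) (k : ℝ)

/-- `β(n, k) = (1/2) √(n min(n, k))`. -/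
def beta (n k : ℕ) : ℝ := 1 / 2 * Real.sqrt ((n : ℝ) * min (n : ℝ) (k : ℝ))

/-- `⌈m / 2⌉`. -/
def halfCeil (m : ℕ) : ℕ := ⌈(m : ℝ) / 2⌉₊

end ShapleyFolkman

end

namespace ShapleyFolkman

/-! ### Sets closed under discrete midpoints -/

/-! Group the sets into k = ⌈m/2⌉ pairs. If a, b lie in the hulls of L♮-convex A, B, then for every
θ in [0,1) the roundings ⌊a+θ⌋ and ⌈b-θ⌉ stay in A and B (`floor_add_mem`, `ceil_sub_mem`); their
sum is a vertex of the unit cube at ⌊a+b⌋ and averages over θ to a+b. So x is a sum of k points,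
each in the hull of those members of a pair sum that are vertices of one unit cube
(`add_mem_hull_cubePart`). `shapley_folkman` makes all but min(n,k) summands members already. Each
remaining one is rounded to a vertex, at cost 1-1/n in the maximum norm (`exists_norm_sub_le`), or
successively, each adding at most n/4 to the squared Euclidean error (`exists_sum_sq_le`). -/

/-- Closure under the rounded-up midpoint. -/
def CeilMidClosed {ι : Type*} (M : Set (ι → ℤ)) : Prop :=
  ∀ x ∈ M, ∀ y ∈ M, (fun i => (x i + y i + 1) / 2) ∈ M

/-- Closure under the rounded-down midpoint. -/
def FloorMidClosed {ι : Type*} (M : Set (ι → ℤ)) : Prop :=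
  ∀ x ∈ M, ∀ y ∈ M, (fun i => (x i + y i) / 2) ∈ M

/-- Replacing q by ⌈(p+q)/2⌉ keeps the set of coordinates where q exceeds p and shrinks the
differences until all are 0 or 1. The window is asymmetric because a difference of -1 rounds up to
0. -/
theorem CeilMidClosed.step_mem {ι : Type*} {M : Set (ι → ℤ)} (h : CeilMidClosed M)
    {p : ι → ℤ} (hp : p ∈ M) (k : ℕ) :
    ∀ q ∈ M, (∀ i, -(k + 1 : ℤ) < q i - p i ∧ q i - p i ≤ k + 1) →
      (fun i => if p i < q i then p i + 1 else p i) ∈ M := by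
  induction k with
  | zero =>
    intro q hq hb
    convert hq using 1
    funext i
    have := hb i
    split_ifs <;> omega
  | succ k ih =>
    intro q hq hb
    convert ih _ (h p hp q hq) ?_ using 1
    · funext i
      have : p i < q i ↔ p i < (p i + q i + 1) / 2 := by omega
      simp only [this]
    · intro i
      have := hb i
      constructor <;> omega

/-- Each `step_mem` raises p by one exactly where it is below q, which leaves p ⊔ q unchanged. -/
theorem CeilMidClosed.sup_mem_of_le {ι : Type*} [Finite ι] {M : Set (ι → ℤ)}
    (h : CeilMidClosed M) {q : ι → ℤ} (hq : q ∈ M) (k : ℕ) :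
    ∀ p ∈ M, (∀ i, q i - p i ≤ k) → p ⊔ q ∈ M := by
  induction k with
  | zero =>
    intro p hp hb
    convert hp using 1
    funext i
    have := hb i
    simp only [Pi.sup_apply]
    omega
  | succ k ih =>
    intro p hp hb
    cases nonempty_fintype ι
    have key := h.step_mem hp (∑ i, (q i - p i).natAbs) q hq (fun i => by
      have := Finset.single_le_sum (f := fun i => (q i - p i).natAbs)
        (fun _ _ => Nat.zero_le _) (Finset.mem_univ i)
      omega)
    convert ih _ key ?_ using 1
    · funext i
      simp only [Pi.sup_apply]
      split_ifs <;> omega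
    · intro i
      have := hb i
      split_ifs <;> omega

theorem CeilMidClosed.sup_mem {ι : Type*} [Finite ι] {M : Set (ι → ℤ)}
    (h : CeilMidClosed M) {p q : ι → ℤ} (hp : p ∈ M) (hq : q ∈ M) : p ⊔ q ∈ M := by
  cases nonempty_fintype ι
  refine h.sup_mem_of_le hq (∑ i, (q i - p i).natAbs) p hp fun i => ?_
  have := Finset.single_le_sum (f := fun i => (q i - p i).natAbs)
    (fun _ _ => Nat.zero_le _) (Finset.mem_univ i)
  omega

theorem FloorMidClosed.neg {ι : Type*} {M : Set (ι → ℤ)} (h : FloorMidClosed M) :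
    CeilMidClosed (-M) := by
  intro x hx y hy
  rw [Set.mem_neg] at *
  convert h _ hx _ hy using 1
  funext i
  simp only [Pi.neg_apply]
  omega

theorem FloorMidClosed.inf_mem {ι : Type*} [Finite ι] {M : Set (ι → ℤ)}
    (h : FloorMidClosed M) {p q : ι → ℤ} (hp : p ∈ M) (hq : q ∈ M) : p ⊓ q ∈ M := by
  have := h.neg.sup_mem (p := -p) (q := -q) (by simpa) (by simpa)
  rwa [← neg_inf, Set.neg_mem_neg] at this

/-- A midpoint-closed set that is invariant under adding constants contains every vector whose
coordinate differences are bounded by those of its members. -/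
theorem mem_of_forall_sub_le {ι : Type*} [Fintype ι] [Nonempty ι] {M : Set (ι → ℤ)}
    (hc : CeilMidClosed M) (hf : FloorMidClosed M)
    (hs : ∀ x ∈ M, ∀ t : ℤ, (fun i => x i + t) ∈ M) {z : ι → ℤ}
    (hz : ∀ i j, ∃ p ∈ M, z i - z j ≤ p i - p j) : z ∈ M := by
  choose p hp hpz using hz
  have huniv : (Finset.univ : Finset ι).Nonempty := Finset.univ_nonempty
  -- `r i j` is the translate of `p i j` that agrees with z at j; it is at least z at i. Hence the
  -- sup over i dominates z with equality at j, and the inf over j is z.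
  let r : ι → ι → ι → ℤ := fun i j l => p i j l + (z j - p i j j)
  have key : (Finset.univ.inf' huniv fun j => Finset.univ.sup' huniv fun i => r i j) ∈ M :=
    Finset.inf'_mem M (fun _ hx _ hy => hf.inf_mem hx hy) _ _ _ fun j _ =>
      Finset.sup'_mem M (fun _ hx _ hy => hc.sup_mem hx hy) _ _ _ fun i _ => hs _ (hp i j) _
  convert key using 1
  funext l
  rw [Finset.inf'_apply]
  apply le_antisymm
  · refine Finset.le_inf' _ _ fun j _ => ?_
    rw [Finset.sup'_apply]
    refine le_trans ?_ (Finset.le_sup' (fun i => r i j l) (Finset.mem_univ l))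
    have := hpz l j
    simp only [r]
    omega
  · refine le_trans (Finset.inf'_le _ (Finset.mem_univ l)) ?_
    rw [Finset.sup'_apply]
    refine Finset.sup'_le _ _ fun i _ => ?_
    simp only [r]
    omega

theorem floor_half_add (a b : ℤ) : ⌊((a : ℝ) + b) / 2⌋ = (a + b) / 2 := by
  have h := Int.floor_div_natCast ((a : ℝ) + b) 2
  rw [← Int.cast_add, Int.floor_intCast] at h
  exact_mod_cast h

theorem ceil_half_add (a b : ℤ) : ⌈((a : ℝ) + b) / 2⌉ = (a + b + 1) / 2 := by
  have h := floor_half_add (-a) (-b)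
  rw [show ((-a : ℤ) + (-b : ℤ) : ℝ) / 2 = -((a + b) / 2) by push_cast; ring, Int.floor_neg] at h
  omega

/-- The set of `f : Option (Fin n) → ℤ` whose dehomogenization lies in `A`. -/
def homogenize {n : ℕ} (A : Set (Fin n → ℤ)) : Set (Option (Fin n) → ℤ) :=
  {f | (fun i => f (some i) - f none) ∈ A}

/-- If the `none` coordinates have odd sum, rounding their midpoint up turns the upper midpoint of
the differences into the lower one, so both closures of A are needed. -/
theorem IsLNatConvex.ceilMidClosed_homogenize {n : ℕ} {A : Set (Fin n → ℤ)}
    (hA : IsLNatConvex A) : CeilMidClosed (homogenize A) := by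
  intro x hx y hy
  have h := hA.2 _ hx _ hy
  simp only [ceil_half_add, floor_half_add] at h
  rw [homogenize, Set.mem_ofPred_eq]
  rcases Int.emod_two_eq_zero_or_one (x none + y none) with h0 | h0
  · convert h.1 using 1
    funext i
    dsimp only
    omega
  · convert h.2 using 1
    funext i
    dsimp only
    omega

theorem IsLNatConvex.floorMidClosed_homogenize {n : ℕ} {A : Set (Fin n → ℤ)}
    (hA : IsLNatConvex A) : FloorMidClosed (homogenize A) := by
  intro x hx y hy
  have h := hA.2 _ hx _ hy
  simp only [ceil_half_add, floor_half_add] at h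
  rw [homogenize, Set.mem_ofPred_eq]
  rcases Int.emod_two_eq_zero_or_one (x none + y none) with h0 | h0
  · convert h.2 using 1
    funext i
    dsimp only
    omega
  · convert h.1 using 1
    funext i
    dsimp only
    omega

theorem exists_le_of_mem_hull {n : ℕ} {A : Set (Fin n → ℤ)} {a : Fin n → ℝ} (ha : a ∈ hull A)
    (g : (Fin n → ℝ) →ₗ[ℝ] ℝ) : ∃ p ∈ A, g a ≤ g (toReal p) := by
  obtain ⟨_, ⟨p, hp, rfl⟩, h⟩ :=
    (g.convexOn convex_univ).exists_ge_of_mem_convexHull (Set.subset_univ _) ha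
  exact ⟨p, hp, h⟩

/-- Threshold rounding keeps points of the convex hull of an L♮-convex set inside the set. -/
theorem IsLNatConvex.floor_add_mem {n : ℕ} {A : Set (Fin n → ℤ)} (hA : IsLNatConvex A)
    {a : Fin n → ℝ} (ha : a ∈ hull A) {θ : ℝ} (h0 : 0 ≤ θ) (h1 : θ < 1) :
    (fun i => ⌊a i + θ⌋) ∈ A := by
  suffices h : (fun o : Option (Fin n) => o.elim 0 fun i => ⌊a i + θ⌋) ∈ homogenize A by
    simpa [homogenize] using h
  have lift : ∀ p ∈ A, (fun o : Option (Fin n) => o.elim 0 p) ∈ homogenize A := by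
    intro p hp
    simpa [homogenize] using hp
  refine mem_of_forall_sub_le hA.ceilMidClosed_homogenize hA.floorMidClosed_homogenize
    (fun x hx t => by simpa [homogenize] using hx) ?_
  rintro (_ | i) (_ | j)
  · obtain ⟨p, hp⟩ := hA.1
    exact ⟨_, lift p hp, by simp⟩
  · obtain ⟨p, hp, h⟩ := exists_le_of_mem_hull ha (-(LinearMap.proj (R := ℝ) (φ := fun _ => ℝ) j))
    refine ⟨_, lift p hp, ?_⟩
    simp only [LinearMap.neg_apply, LinearMap.proj_apply, toReal] at h
    have : p j ≤ ⌊a j + θ⌋ := Int.le_floor.2 (by linarith)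
    simpa using this
  · obtain ⟨p, hp, h⟩ := exists_le_of_mem_hull ha (LinearMap.proj (R := ℝ) (φ := fun _ => ℝ) i)
    refine ⟨_, lift p hp, ?_⟩
    simp only [LinearMap.proj_apply, toReal] at h
    have : ⌊a i + θ⌋ < p i + 1 := Int.floor_lt.2 (by push_cast; linarith)
    simp only [Option.elim_some, Option.elim_none]
    omega
  · obtain ⟨p, hp, h⟩ := exists_le_of_mem_hull ha
      (LinearMap.proj (R := ℝ) (φ := fun _ => ℝ) i - LinearMap.proj j)
    refine ⟨_, lift p hp, ?_⟩
    simp only [LinearMap.sub_apply, LinearMap.proj_apply, toReal] at h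
    have : ⌊a i + θ⌋ - (p i - p j) ≤ ⌊a j + θ⌋ := by
      refine Int.le_floor.2 ?_
      have := Int.floor_le (a i + θ)
      push_cast
      linarith
    simp only [Option.elim_some]
    omega

theorem IsLNatConvex.neg {n : ℕ} {A : Set (Fin n → ℤ)} (hA : IsLNatConvex A) :
    IsLNatConvex (-A) := by
  refine ⟨hA.1.neg, fun x hx y hy => ?_⟩
  have h := hA.2 _ hx _ hy
  simp only [ceil_half_add, floor_half_add, Set.mem_neg, Pi.neg_apply] at h ⊢
  constructor
  · convert h.2 using 1
    funext i
    simp only [Pi.neg_apply]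
    omega
  · convert h.1 using 1
    funext i
    simp only [Pi.neg_apply]
    omega

theorem neg_mem_hull_neg {n : ℕ} {A : Set (Fin n → ℤ)} {a : Fin n → ℝ} (ha : a ∈ hull A) :
    -a ∈ hull (-A) := by
  have : toReal '' (-A) = -(toReal '' A) := by
    ext x
    simp only [Set.mem_image, Set.mem_neg]
    constructor
    · rintro ⟨p, hp, rfl⟩
      exact ⟨-p, hp, by funext i; simp [toReal]⟩
    · rintro ⟨p, hp, h⟩
      refine ⟨-p, by simpa, ?_⟩
      rw [← neg_neg x, ← h]
      funext i
      simp [toReal]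
  rw [hull, this, convexHull_neg]
  simpa [hull] using ha

theorem IsLNatConvex.ceil_sub_mem {n : ℕ} {A : Set (Fin n → ℤ)} (hA : IsLNatConvex A)
    {a : Fin n → ℝ} (ha : a ∈ hull A) {θ : ℝ} (h0 : 0 ≤ θ) (h1 : θ < 1) :
    (fun i => ⌈a i - θ⌉) ∈ A := by
  have h := hA.neg.floor_add_mem (neg_mem_hull_neg ha) h0 h1
  rw [Set.mem_neg] at h
  convert h using 1
  funext i
  rw [Pi.neg_apply, Pi.neg_apply, ← Int.ceil_neg]
  congr 1
  ring

/-! ### The Shapley–Folkman lemma -/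

/-- On the hyperplane φ = 1 a vanishing combination has total weight 0. This saves one point in the
Carathéodory count. -/
theorem linearIndependent_of_affineIndependent {ι V : Type*} [AddCommGroup V] [Module ℝ V]
    {z : ι → V} (hz : AffineIndependent ℝ z) (φ : V →ₗ[ℝ] ℝ) (hφ : ∀ i, φ (z i) = 1) :
    LinearIndependent ℝ z := by
  rw [linearIndependent_iff']
  intro s g hg
  refine affineIndependent_iff.1 hz s g ?_ hg
  simpa [hφ] using congrArg φ hg

/-- Shapley–Folkman: a sum of points of convex hulls can be rewritten so that all but at most
`n` summands lie in the sets themselves. -/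
theorem shapley_folkman {n k : ℕ} (hk : 0 < k) (T : Fin k → Set (Fin n → ℝ))
    (y : Fin k → Fin n → ℝ) (hy : ∀ j, y j ∈ convexHull ℝ (T j)) :
    ∃ y' : Fin k → Fin n → ℝ, (∀ j, y' j ∈ convexHull ℝ (T j)) ∧ ∑ j, y' j = ∑ j, y j ∧
      ∃ J : Finset (Fin k), J.card ≤ n ∧ ∀ j ∉ J, y' j ∈ T j := by
  classical
  -- Tagging points of `T j` with the j-th basis vector turns membership in all k hulls into one
  -- Carathéodory problem in dimension n + k.
  let U : Set ((Fin n → ℝ) × (Fin k → ℝ)) := ⋃ j, T j ×ˢ {Pi.single j 1}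
  have hk' : (k : ℝ) ≠ 0 := by positivity
  have hU : ((k : ℝ)⁻¹ • ∑ j, y j, fun _ => (k : ℝ)⁻¹) ∈ convexHull ℝ U := by
    have h1 : ∀ j ∈ Finset.univ, (y j, (Pi.single j 1 : Fin k → ℝ)) ∈ convexHull ℝ U := by
      intro j _
      refine convexHull_mono (Set.subset_iUnion _ j) ?_
      rw [convexHull_prod]
      exact ⟨hy j, by simp⟩
    have h2 := (convex_convexHull ℝ U).sum_mem (t := Finset.univ) (w := fun _ => (k : ℝ)⁻¹)
      (fun _ _ => by positivity) (by simp [hk']) h1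
    convert h2 using 1
    refine Prod.ext ?_ ?_
    · simp [Prod.fst_sum, Finset.smul_sum]
    · funext l
      simp [Prod.snd_sum, Pi.single_apply]
  obtain ⟨ι, _, z, w, hzU, hz, hw, hw1, hwz⟩ := eq_pos_convex_span_of_mem_convexHull hU
  have hz' : ∀ i, ∃ j, (z i).1 ∈ T j ∧ (z i).2 = Pi.single j 1 := by
    intro i
    simpa [U] using hzU ⟨i, rfl⟩
  choose g hgT hg using hz'
  have hfib : ∀ j, ∑ i with g i = j, w i = (k : ℝ)⁻¹ := by
    intro j
    have := congrFun (congrArg Prod.snd hwz) j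
    simpa [Prod.snd_sum, hg, Pi.single_apply, Finset.sum_filter, eq_comm] using this
  have hcard : Fintype.card ι ≤ n + k := by
    have hli := linearIndependent_of_affineIndependent hz
      ((∑ j, LinearMap.proj (R := ℝ) (φ := fun _ : Fin k => ℝ) j) ∘ₗ LinearMap.snd ℝ _ _)
      (fun i => by simp [hg])
    simpa using hli.fintype_card_le_finrank
  have hpos : ∀ j, 1 ≤ (Finset.univ.filter fun i => g i = j).card := by
    intro j
    rw [Nat.one_le_iff_ne_zero, Finset.card_ne_zero]
    refine Finset.nonempty_of_sum_ne_zero (f := w) ?_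
    rw [hfib]
    positivity
  refine ⟨fun j => ∑ i with g i = j, ((k : ℝ) * w i) • (z i).1, fun j => ?_, ?_,
    Finset.univ.filter fun j => 2 ≤ (Finset.univ.filter fun i => g i = j).card, ?_, ?_⟩
  · refine (convex_convexHull ℝ (T j)).sum_mem (fun i _ => by have := (hw i).le; positivity) ?_ ?_
    · rw [← Finset.mul_sum, hfib, mul_inv_cancel₀ hk']
    · intro i hi
      obtain rfl : g i = j := by simpa using hi
      exact subset_convexHull ℝ _ (hgT i)
  · rw [Finset.sum_fiberwise]
    have := congrArg Prod.fst hwz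
    simp only [Prod.fst_sum, Prod.smul_fst] at this
    simp only [mul_smul]
    rw [← Finset.smul_sum, this, smul_inv_smul₀ hk']
  -- At most n + k points fill k nonempty fibres, so at most n fibres have two or more.
  · have h1 : ∑ j, (Finset.univ.filter fun i => g i = j).card = Fintype.card ι := by
      rw [← Finset.card_eq_sum_card_fiberwise (fun _ _ => Finset.mem_coe.2 (Finset.mem_univ _))]
      rfl
    have h2 : ∑ j, (1 + if 2 ≤ (Finset.univ.filter fun i => g i = j).card then 1 else 0)
        ≤ ∑ j, (Finset.univ.filter fun i => g i = j).card := by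
      refine Finset.sum_le_sum fun j _ => ?_
      have := hpos j
      split_ifs <;> omega
    rw [Finset.sum_add_distrib, ← Finset.card_filter] at h2
    simp only [Finset.sum_const, Finset.card_univ, Fintype.card_fin, smul_eq_mul, mul_one] at h2
    omega
  · intro j hj
    have h1 : (Finset.univ.filter fun i => g i = j).card = 1 := by
      have := hpos j
      simp only [Finset.mem_filter, Finset.mem_univ, true_and] at hj
      omega
    obtain ⟨i, hi⟩ := Finset.card_eq_one.1 h1
    have h2 := hfib j
    have hij : i ∈ Finset.univ.filter fun i => g i = j := hi ▸ Finset.mem_singleton_self i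
    obtain rfl : g i = j := by simpa using hij
    rw [hi, Finset.sum_singleton] at h2
    simp only [hi, Finset.sum_singleton, h2, mul_inv_cancel₀ hk', one_smul]
    exact hgT i

/-! ### Integral convexity of the sum of two L♮-convex sets -/

theorem intervalIntegrable_floor_add (a s t : ℝ) :
    IntervalIntegrable (fun θ : ℝ => (⌊a + θ⌋ : ℝ)) MeasureTheory.volume s t :=
  Monotone.intervalIntegrable fun x y h => by
    have := Int.floor_mono (add_le_add_right h a)
    exact_mod_cast this

/-- The fractional part has mean 1/2 over every period, as does θ on [0,1]. -/
theorem integral_floor_add (a : ℝ) : ∫ θ in (0 : ℝ)..1, (⌊a + θ⌋ : ℝ) = a := by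
  have h1 : ∫ θ in (0 : ℝ)..1, Int.fract (a + θ) = 1 / 2 := by
    have hper : Function.Periodic (Int.fract : ℝ → ℝ) 1 := fun x => Int.fract_add_one x
    have h2 := hper.intervalIntegral_add_eq a 0
    rw [intervalIntegral.integral_comp_add_left (fun x => Int.fract x), add_zero, h2, zero_add,
      intervalIntegral.integral_of_le zero_le_one, MeasureTheory.integral_Ioc_eq_integral_Ioo,
      MeasureTheory.setIntegral_congr_fun (g := fun x => x) measurableSet_Ioo
        (fun x hx => Int.fract_eq_self.2 ⟨hx.1.le, hx.2⟩),
      ← MeasureTheory.integral_Ioc_eq_integral_Ioo,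
      ← intervalIntegral.integral_of_le zero_le_one, integral_id]
    norm_num
  have h3 : ∫ θ in (0 : ℝ)..1, ((a + θ) - (⌊a + θ⌋ : ℝ)) = 1 / 2 := h1
  rw [intervalIntegral.integral_sub (by apply Continuous.intervalIntegrable; fun_prop)
    (intervalIntegrable_floor_add _ _ _), intervalIntegral.integral_add (by simp) (by simp)] at h3
  simp only [intervalIntegral.integral_const, integral_id] at h3
  norm_num at h3
  linarith

/-- The integer points of `W` in the unit cube with lower corner `⌊x⌋`. -/
def cubePart {n : ℕ} (W : Set (Fin n → ℤ)) (x : Fin n → ℝ) : Set (Fin n → ℤ) :=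
  {z ∈ W | ∀ c, z c = ⌊x c⌋ ∨ z c = ⌊x c⌋ + 1}

theorem finite_cubePart {n : ℕ} (W : Set (Fin n → ℤ)) (x : Fin n → ℝ) :
    (cubePart W x).Finite := by
  refine (Set.finite_Icc (fun c => ⌊x c⌋) (fun c => ⌊x c⌋ + 1)).subset fun z hz => ?_
  constructor <;> intro c <;> have := hz.2 c <;> dsimp only <;> omega

theorem IsLNatConvex.add_mem_hull_cubePart {n : ℕ} {A B : Set (Fin n → ℤ)}
    (hA : IsLNatConvex A) (hB : IsLNatConvex B) {a b : Fin n → ℝ} (ha : a ∈ hull A)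
    (hb : b ∈ hull B) : a + b ∈ hull (cubePart (A + B) (a + b)) := by
  let F : ℝ → Fin n → ℝ := fun θ => toReal fun c => ⌊a c + θ⌋ + ⌈b c - θ⌉
  have hF : ∀ θ ∈ Set.Ico (0 : ℝ) 1, F θ ∈ hull (cubePart (A + B) (a + b)) := by
    intro θ hθ
    refine subset_convexHull ℝ _ ⟨_, ⟨Set.add_mem_add (hA.floor_add_mem ha hθ.1 hθ.2)
      (hB.ceil_sub_mem hb hθ.1 hθ.2), fun c => ?_⟩, rfl⟩
    have h1 := Int.floor_le (a c + θ)
    have h2 := Int.lt_floor_add_one (a c + θ)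
    have h3 := Int.le_ceil (b c - θ)
    have h4 := Int.ceil_lt_add_one (b c - θ)
    have h5 : ⌊a c + b c⌋ < ⌊a c + θ⌋ + ⌈b c - θ⌉ + 1 := by
      refine Int.floor_lt.2 ?_
      push_cast
      linarith
    have h6 : ⌊a c + θ⌋ + ⌈b c - θ⌉ - 1 ≤ ⌊a c + b c⌋ := by
      refine Int.le_floor.2 ?_
      push_cast
      linarith
    simp only [Pi.add_apply]
    omega
  have hFc : ∀ c θ, F θ c = (⌊a c + θ⌋ : ℝ) - (⌊-b c + θ⌋ : ℝ) := by
    intro c θ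
    rw [show -b c + θ = -(b c - θ) by ring, Int.floor_neg]
    simp [F, toReal]
  have hint : ∀ c, MeasureTheory.IntegrableOn (fun θ => F θ c) (Set.Ico (0 : ℝ) 1) := by
    intro c
    simp only [hFc]
    rw [integrableOn_Ico_iff_integrableOn_Ioo, ← integrableOn_Ioc_iff_integrableOn_Ioo,
      ← intervalIntegrable_iff_integrableOn_Ioc_of_le zero_le_one]
    exact (intervalIntegrable_floor_add _ _ _).sub (intervalIntegrable_floor_add _ _ _)
  have : MeasureTheory.IsProbabilityMeasure
      (MeasureTheory.volume.restrict (Set.Ico (0 : ℝ) 1)) := ⟨by simp⟩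
  -- Finiteness of the cube part makes its hull closed, so the mean over θ stays inside.
  have key := (convex_convexHull ℝ _).integral_mem
    (((finite_cubePart (A + B) (a + b)).image toReal).isClosed_convexHull ℝ)
    ((MeasureTheory.ae_restrict_iff' measurableSet_Ico).2 (.of_forall hF))
    (MeasureTheory.Integrable.of_eval hint)
  suffices h : ∫ θ in Set.Ico (0 : ℝ) 1, F θ = a + b by rwa [h] at key
  funext c
  rw [MeasureTheory.eval_integral hint]
  simp only [hFc]
  rw [MeasureTheory.integral_Ico_eq_integral_Ioc, ← intervalIntegral.integral_of_le zero_le_one,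
    intervalIntegral.integral_sub (intervalIntegrable_floor_add _ _ _)
      (intervalIntegrable_floor_add _ _ _), integral_floor_add, integral_floor_add]
  simp

/-! ### Rounding points of the convex hull of a subset of a unit cube -/

/-- `T` consists of vertices of the unit cube with lower corner `f`. -/
def InCube {n : ℕ} (T : Set (Fin n → ℝ)) (f : Fin n → ℝ) : Prop :=
  ∀ p ∈ T, ∀ c, p c = f c ∨ p c = f c + 1

/-- An affine function given coordinatewise does not exceed its value at `y` at some point
of `T`. -/
theorem exists_sum_mul_add_le {n : ℕ} {T : Set (Fin n → ℝ)} {y : Fin n → ℝ}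
    (hy : y ∈ convexHull ℝ T) (u v : Fin n → ℝ) :
    ∃ p ∈ T, ∑ c, (u c * p c + v c) ≤ ∑ c, (u c * y c + v c) := by
  have hg : ConcaveOn ℝ Set.univ fun p : Fin n → ℝ => ∑ c, (u c * p c + v c) := by
    refine ⟨convex_univ, fun p _ q _ s t _ _ hst => le_of_eq ?_⟩
    simp only [smul_eq_mul, Finset.mul_sum, ← Finset.sum_add_distrib]
    refine Finset.sum_congr rfl fun c _ => ?_
    simp only [Pi.add_apply, Pi.smul_apply, smul_eq_mul]
    linear_combination (v c) * hst
  exact hg.exists_le_of_mem_convexHull (Set.subset_univ _) hy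

theorem InCube.mem_Icc {n : ℕ} {T : Set (Fin n → ℝ)} {f y : Fin n → ℝ} (hT : InCube T f)
    (hy : y ∈ convexHull ℝ T) (c : Fin n) : f c ≤ y c ∧ y c ≤ f c + 1 := by
  have h : T ⊆ Set.Icc f (f + 1) := fun p hp => by
    constructor <;> intro c <;> rcases hT p hp c with h | h <;> simp [h]
  have := convexHull_min h (convex_Icc _ _) hy
  exact ⟨this.1 c, this.2 c⟩

theorem InCube.exists_norm_sub_le {n : ℕ} (hn : 2 ≤ n) {T : Set (Fin n → ℝ)} {f y : Fin n → ℝ}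
    (hT : InCube T f) (hy : y ∈ convexHull ℝ T) :
    ∃ p ∈ T, ‖y - p‖ ≤ 1 - 1 / (n : ℝ) := by
  classical
  have hn' : (2 : ℝ) ≤ n := by exact_mod_cast hn
  have hn1 : 1 / (n : ℝ) ≤ 1 / 2 := by gcongr
  -- At a cube vertex p, `u c * p c + v c` is 1 if coordinate c errs by more than 1 - 1/n and 0
  -- otherwise. At y each term is below 1/n, so the sum is below 1 and some p has no bad coordinate.
  let u : Fin n → ℝ := fun c =>
    if y c - f c < 1 / n then 1 else if 1 - 1 / (n : ℝ) < y c - f c then -1 else 0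
  let v : Fin n → ℝ := fun c =>
    if y c - f c < 1 / n then -f c else if 1 - 1 / (n : ℝ) < y c - f c then 1 + f c else 0
  obtain ⟨p, hp, hle⟩ := exists_sum_mul_add_le hy u v
  refine ⟨p, hp, (pi_norm_le_iff_of_nonneg (by linarith)).2 fun c => ?_⟩
  have hlt : ∑ c, (u c * y c + v c) < 1 := by
    calc ∑ c, (u c * y c + v c) < ∑ _c : Fin n, 1 / (n : ℝ) := by
          refine Finset.sum_lt_sum_of_nonempty ⟨c, Finset.mem_univ c⟩ fun c _ => ?_
          simp only [u, v]
          split_ifs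
          · linarith
          · linarith
          · simp only [zero_mul, add_zero]; positivity
      _ = 1 := by
          rw [Finset.sum_const, Finset.card_univ, Fintype.card_fin, nsmul_eq_mul]
          field_simp
  have hnn : ∀ c, 0 ≤ u c * p c + v c := by
    intro c
    simp only [u, v]
    rcases hT p hp c with h | h <;> rw [h] <;> split_ifs <;> linarith
  have hc := (Finset.single_le_sum (fun c _ => hnn c) (Finset.mem_univ c)).trans_lt
    (hle.trans_lt hlt)
  have hb := hT.mem_Icc hy c
  simp only [u, v] at hc
  rw [Pi.sub_apply, Real.norm_eq_abs, abs_le]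
  rcases hT p hp c with h | h <;> rw [h] at hc ⊢ <;> split_ifs at hc <;>
    constructor <;> linarith

/-- On cube vertices (p-f)² = p-f, so the squared error is affine in p. With t = y-f, that affine
function takes the value ∑ (v² + t(1-t)) at y, and t(1-t) ≤ 1/4. -/
theorem InCube.exists_sum_sq_le {n : ℕ} {T : Set (Fin n → ℝ)} {f y : Fin n → ℝ}
    (hT : InCube T f) (hy : y ∈ convexHull ℝ T) (v : Fin n → ℝ) :
    ∃ p ∈ T, ∑ c, (v c + (y c - p c)) ^ 2 ≤ ∑ c, v c ^ 2 + n / 4 := by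
  obtain ⟨p, hp, hle⟩ := exists_sum_mul_add_le hy (fun c => 1 - 2 * (v c + (y c - f c)))
    (fun c => (v c + (y c - f c)) ^ 2 - (1 - 2 * (v c + (y c - f c))) * f c)
  refine ⟨p, hp, ?_⟩
  calc ∑ c, (v c + (y c - p c)) ^ 2
      = ∑ c, ((1 - 2 * (v c + (y c - f c))) * p c
          + ((v c + (y c - f c)) ^ 2 - (1 - 2 * (v c + (y c - f c))) * f c)) := by
        refine Finset.sum_congr rfl fun c _ => ?_
        rcases hT p hp c with h | h <;> rw [h] <;> ring
    _ ≤ _ := hle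
    _ ≤ ∑ c, (v c ^ 2 + 1 / 4) := by
        refine Finset.sum_le_sum fun c _ => ?_
        nlinarith [sq_nonneg (y c - f c - 1 / 2)]
    _ = ∑ c, v c ^ 2 + n / 4 := by
        rw [Finset.sum_add_distrib]
        simp [div_eq_mul_inv]

theorem exists_sum_sq_sum_le {n : ℕ} {κ : Type*} [DecidableEq κ] {T : κ → Set (Fin n → ℝ)}
    {f y : κ → Fin n → ℝ} (hT : ∀ j, InCube (T j) (f j)) (hy : ∀ j, y j ∈ convexHull ℝ (T j))
    (J : Finset κ) :
    ∃ p : κ → Fin n → ℝ, (∀ j ∈ J, p j ∈ T j) ∧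
      ∑ c, (∑ j ∈ J, (y j c - p j c)) ^ 2 ≤ J.card * (n / 4 : ℝ) := by
  induction J using Finset.induction_on with
  | empty => exact ⟨y, by simp, by simp⟩
  | insert j J hj ih =>
    obtain ⟨p, hp, hle⟩ := ih
    -- The error accumulated so far enters as the offset v.
    obtain ⟨q, hq, hqle⟩ := (hT j).exists_sum_sq_le (hy j) fun c => ∑ j ∈ J, (y j c - p j c)
    refine ⟨Function.update p j q, fun i hi => ?_, ?_⟩
    · rcases Finset.mem_insert.1 hi with rfl | hi'
      · simpa
      · rw [Function.update_of_ne (by rintro rfl; exact hj hi')]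
        exact hp i hi'
    · have h1 : ∀ c, ∑ i ∈ insert j J, (y i c - Function.update p j q i c)
          = ∑ i ∈ J, (y i c - p i c) + (y j c - q c) := by
        intro c
        rw [Finset.sum_insert hj, Function.update_self, add_comm]
        congr 1
        refine Finset.sum_congr rfl fun i hi => ?_
        rw [Function.update_of_ne (by rintro rfl; exact hj hi)]
      simp only [h1]
      rw [Finset.card_insert_of_notMem hj]
      push_cast
      linarith

theorem norm_le_norm2 {n : ℕ} (x : Fin n → ℝ) : ‖x‖ ≤ norm2 x :=
  (pi_norm_le_iff_of_nonneg (norm_nonneg _)).2 fun i =>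
    PiLp.norm_apply_le (WithLp.toLp 2 x) i

theorem norm2_le {n : ℕ} {x : Fin n → ℝ} {N : ℕ} {r : ℝ} (hN : (N : ℝ) ≤ r)
    (h : ∑ c, x c ^ 2 ≤ N * (n / 4 : ℝ)) : norm2 x ≤ 1 / 2 * Real.sqrt (n * r) := by
  rw [norm2, EuclideanSpace.norm_eq, ← Real.sqrt_sq (by norm_num : (0 : ℝ) ≤ 1 / 2),
    ← Real.sqrt_mul (by positivity)]
  refine Real.sqrt_le_sqrt ?_
  simp only [Real.norm_eq_abs, sq_abs]
  have : (n : ℝ) * N ≤ n * r := by gcongr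
  linarith

/-- Rounding a sum of points of convex hulls of subsets of unit cubes, in both norms. -/
theorem exists_rounding {n k : ℕ} (hn : 2 ≤ n) (hk : 0 < k) (T : Fin k → Set (Fin n → ℝ))
    (f y : Fin k → Fin n → ℝ) (hT : ∀ j, InCube (T j) (f j))
    (hy : ∀ j, y j ∈ convexHull ℝ (T j)) :
    (∃ p : Fin k → Fin n → ℝ, (∀ j, p j ∈ T j) ∧ ‖∑ j, y j - ∑ j, p j‖ ≤ alpha n k) ∧
    (∃ p : Fin k → Fin n → ℝ, (∀ j, p j ∈ T j) ∧ norm2 (∑ j, y j - ∑ j, p j) ≤ beta n k) := by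
  classical
  obtain ⟨y', hy', hsum, J, hJ, hJT⟩ := shapley_folkman hk T y hy
  have hcard : (J.card : ℝ) ≤ min (n : ℝ) k := by
    refine le_min (by exact_mod_cast hJ) ?_
    have := J.card_le_univ
    rw [Fintype.card_fin] at this
    exact_mod_cast this
  rw [← hsum]
  have hsplit : ∀ p : Fin k → Fin n → ℝ,
      ∑ j, y' j - ∑ j, (if j ∈ J then p j else y' j) = ∑ j ∈ J, (y' j - p j) := by
    intro p
    rw [← Finset.sum_sub_distrib, ← Finset.sum_filter_add_sum_filter_not _ (· ∈ J),
      Finset.filter_univ_mem]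
    rw [Finset.sum_congr rfl (fun j hj => by rw [if_pos hj]), add_eq_left]
    refine Finset.sum_eq_zero fun j hj => ?_
    rw [if_neg (by simpa using hj), sub_self]
  constructor
  · choose p hp hpn using fun j => (hT j).exists_norm_sub_le hn (hy' j)
    refine ⟨fun j => if j ∈ J then p j else y' j, fun j => ?_, ?_⟩
    · dsimp only
      split_ifs with h
      exacts [hp j, hJT j h]
    · rw [hsplit]
      have h1 : (0 : ℝ) ≤ 1 - 1 / n := (norm_nonneg _).trans (hpn ⟨0, hk⟩)
      calc ‖∑ j ∈ J, (y' j - p j)‖ ≤ ∑ j ∈ J, (1 - 1 / (n : ℝ)) :=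
            norm_sum_le_of_le _ fun j _ => hpn j
        _ = (1 - 1 / (n : ℝ)) * J.card := by rw [Finset.sum_const, nsmul_eq_mul, mul_comm]
        _ ≤ alpha n k := mul_le_mul_of_nonneg_left hcard h1
  · obtain ⟨p, hp, hle⟩ := exists_sum_sq_sum_le hT hy' J
    refine ⟨fun j => if j ∈ J then p j else y' j, fun j => ?_, ?_⟩
    · dsimp only
      split_ifs with h
      exacts [hp j h, hJT j h]
    · rw [hsplit]
      refine norm2_le hcard ?_
      simpa [Finset.sum_apply] using hle

/-! ### Minkowski sums -/

theorem toReal_add {n : ℕ} (x y : Fin n → ℤ) : toReal (x + y) = toReal x + toReal y := by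
  funext i
  simp [toReal]

theorem toReal_sum {n : ℕ} {κ : Type*} (s : Finset κ) (z : κ → Fin n → ℤ) :
    toReal (∑ j ∈ s, z j) = ∑ j ∈ s, toReal (z j) := by
  funext i
  simp [toReal]

theorem hull_add {n : ℕ} (A B : Set (Fin n → ℤ)) : hull (A + B) = hull A + hull B := by
  rw [hull, hull, hull, ← convexHull_add]
  congr 1
  exact Set.image_image2_distrib toReal_add

theorem hull_zero {n : ℕ} : hull (0 : Set (Fin n → ℤ)) = 0 := by
  have : toReal (0 : Fin n → ℤ) = 0 := by
    funext i
    simp [toReal]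
  rw [hull, ← Set.singleton_zero, Set.image_singleton, this, convexHull_singleton,
    Set.singleton_zero]

theorem hull_sum {n : ℕ} {κ : Type*} [DecidableEq κ] (s : Finset κ) (A : κ → Set (Fin n → ℤ)) :
    hull (∑ j ∈ s, A j) = ∑ j ∈ s, hull (A j) := by
  induction s using Finset.induction_on with
  | empty => simp [hull_zero]
  | insert j s hj ih => rw [Finset.sum_insert hj, Finset.sum_insert hj, hull_add, ih]

theorem isLNatConvex_zero {n : ℕ} : IsLNatConvex (0 : Set (Fin n → ℤ)) := by
  refine ⟨⟨0, rfl⟩, ?_⟩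
  rintro x rfl y rfl
  simp [Set.mem_zero, funext_iff]

theorem sum_range_two_mul {M : Type*} [AddCommMonoid M] (g : ℕ → M) (k : ℕ) :
    ∑ i ∈ Finset.range (2 * k), g i = ∑ j ∈ Finset.range k, (g (2 * j) + g (2 * j + 1)) := by
  induction k with
  | zero => simp
  | succ k ih =>
    rw [Nat.mul_succ, Finset.sum_range_succ, Finset.sum_range_succ, ih, Finset.sum_range_succ,
      add_assoc]

theorem halfCeil_eq (m : ℕ) : halfCeil m = (m + 1) / 2 := by
  rw [halfCeil]
  apply le_antisymm
  · rw [Nat.ceil_le, div_le_iff₀ (by norm_num)]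
    have : m ≤ (m + 1) / 2 * 2 := by omega
    exact_mod_cast this
  · have h := Nat.le_ceil ((m : ℝ) / 2)
    rw [div_le_iff₀ (by norm_num)] at h
    have : m ≤ ⌈(m : ℝ) / 2⌉₊ * 2 := by exact_mod_cast h
    omega

/-- A sum of `m` L♮-convex sets is a sum of `⌈m / 2⌉` pairs of such sets. -/
theorem exists_pairs {n m : ℕ} (S : Fin m → Set (Fin n → ℤ)) (hS : ∀ i, IsLNatConvex (S i)) :
    ∃ A B : Fin (halfCeil m) → Set (Fin n → ℤ), (∀ j, IsLNatConvex (A j)) ∧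
      (∀ j, IsLNatConvex (B j)) ∧ ∑ i, S i = ∑ j, (A j + B j) := by
  -- Padding with {0} supplies the missing partner when m is odd.
  let S' : ℕ → Set (Fin n → ℤ) := fun i => if h : i < m then S ⟨i, h⟩ else 0
  have hS' : ∀ i, IsLNatConvex (S' i) := by
    intro i
    simp only [S']
    split_ifs
    exacts [hS _, isLNatConvex_zero]
  refine ⟨fun j => S' (2 * j), fun j => S' (2 * j + 1), fun _ => hS' _, fun _ => hS' _, ?_⟩
  rw [Fin.sum_univ_eq_sum_range (fun j => S' (2 * j) + S' (2 * j + 1)), ← sum_range_two_mul]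
  have hm : m ≤ 2 * halfCeil m := by
    rw [halfCeil_eq]
    omega
  rw [← Finset.sum_subset (Finset.range_mono hm) (fun i _ hi => by
    simp only [S']
    rw [dif_neg (by simpa using hi)]), ← Fin.sum_univ_eq_sum_range]
  exact Finset.sum_congr rfl fun i _ => by simp [S']

theorem exists_near {n k : ℕ} (hn : 2 ≤ n) (hk : 0 < k) (A B : Fin k → Set (Fin n → ℤ))
    (hA : ∀ j, IsLNatConvex (A j)) (hB : ∀ j, IsLNatConvex (B j)) {x : Fin n → ℝ}
    (hx : x ∈ hull (∑ j, (A j + B j))) :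
    (∃ z ∈ ∑ j, (A j + B j), ‖x - toReal z‖ ≤ alpha n k) ∧
    (∃ z ∈ ∑ j, (A j + B j), norm2 (x - toReal z) ≤ beta n k) := by
  rw [hull_sum, Set.mem_fintype_sum] at hx
  obtain ⟨y, hy, rfl⟩ := hx
  have hy' : ∀ j, y j ∈ hull (cubePart (A j + B j) (y j)) := by
    intro j
    have := hy j
    rw [hull_add] at this
    obtain ⟨a, ha, b, hb, hab⟩ := this
    rw [← hab]
    exact (hA j).add_mem_hull_cubePart (hB j) ha hb
  have hT : ∀ j, InCube (toReal '' cubePart (A j + B j) (y j)) (fun c => (⌊y j c⌋ : ℝ)) := by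
    rintro j _ ⟨p, hp, rfl⟩ c
    rcases hp.2 c with h | h <;> simp [toReal, h]
  have hlift : ∀ p : Fin k → Fin n → ℝ, (∀ j, p j ∈ toReal '' cubePart (A j + B j) (y j)) →
      ∃ z ∈ ∑ j, (A j + B j), toReal z = ∑ j, p j := by
    intro p hp
    choose z hz hzp using hp
    refine ⟨∑ j, z j, (Set.mem_fintype_sum _ _).2 ⟨z, fun j => (hz j).1, rfl⟩, ?_⟩
    rw [toReal_sum]
    exact Finset.sum_congr rfl fun j _ => hzp j
  obtain ⟨⟨p, hp, hpn⟩, ⟨q, hq, hqn⟩⟩ := exists_rounding hn hk _ _ y hT hy'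
  obtain ⟨z, hz, hzp⟩ := hlift p hp
  obtain ⟨w, hw, hwq⟩ := hlift q hq
  exact ⟨⟨z, hz, hzp ▸ hpn⟩, ⟨w, hw, hwq ▸ hqn⟩⟩

theorem norm_sub_le_floor {n : ℕ} {x : Fin n → ℝ} {z : Fin n → ℤ} {r : ℝ}
    (h : ‖x - toReal z‖ ≤ r) (hx : IsIntegral x) : ‖x - toReal z‖ ≤ (⌊r⌋ : ℝ) := by
  obtain ⟨w, rfl⟩ := hx
  have hr : 0 ≤ r := (norm_nonneg _).trans h
  refine (pi_norm_le_iff_of_nonneg (by exact_mod_cast Int.floor_nonneg.2 hr)).2 fun i => ?_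
  have h1 := (norm_le_pi_norm (toReal w - toReal z) i).trans h
  have h2 : ‖(toReal w - toReal z) i‖ = ((|w i - z i| : ℤ) : ℝ) := by
    simp [toReal]
  rw [h2] at h1 ⊢
  exact_mod_cast Int.le_floor.2 h1

/-- With μ = min(n,k), α = μ - μ/n and 0 < μ/n ≤ 1. -/
theorem floor_alpha {n k : ℕ} (hn : 2 ≤ n) (hk : 0 < k) :
    ⌊alpha n k⌋ = min (n : ℤ) (k : ℤ) - 1 := by
  have hn0 : (0 : ℝ) < n := by positivity
  have hm : (0 : ℝ) < min (n : ℝ) k := lt_min hn0 (by exact_mod_cast hk)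
  have h1 : min (n : ℝ) k / n ≤ 1 := (div_le_one hn0).2 (min_le_left _ _)
  have h2 : 0 < min (n : ℝ) k / n := div_pos hm hn0
  have h3 : alpha n k = min (n : ℝ) k - min (n : ℝ) k / n := by
    rw [alpha]
    ring
  rw [Int.floor_eq_iff, h3]
  push_cast
  constructor <;> linarith

end ShapleyFolkman

theorem mainTheorem4 (n m : ℕ) (hn : 2 ≤ n) (hm : 1 ≤ m)
    (S : Fin m → Set (Fin n → ℤ)) (hS : ∀ i, ShapleyFolkman.IsLNatConvex (S i))
    (W : Set (Fin n → ℤ)) (hW : W = ∑ i, S i)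
    (x : Fin n → ℝ) (hx : x ∈ ShapleyFolkman.hull W) :
    -- (1)
    ((∃ z ∈ W,
        ‖x - ShapleyFolkman.toReal z‖
          ≤ ShapleyFolkman.alpha n (ShapleyFolkman.halfCeil m) ∧
        (ShapleyFolkman.IsIntegral x →
          ‖x - ShapleyFolkman.toReal z‖
            ≤ (⌊ShapleyFolkman.alpha n (ShapleyFolkman.halfCeil m)⌋ : ℝ))) ∧
      ⌊ShapleyFolkman.alpha n (ShapleyFolkman.halfCeil m)⌋
        = min (n : ℤ) (ShapleyFolkman.halfCeil m : ℤ) - 1) ∧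
    -- (2)
    (∃ z ∈ W,
        ShapleyFolkman.norm2 (x - ShapleyFolkman.toReal z)
          ≤ ShapleyFolkman.beta n (ShapleyFolkman.halfCeil m) ∧
        (ShapleyFolkman.IsIntegral x →
          ‖x - ShapleyFolkman.toReal z‖
            ≤ (⌊ShapleyFolkman.beta n (ShapleyFolkman.halfCeil m)⌋ : ℝ))) ∧
    -- (3)
    (∃ z ∈ W,
        ‖x - ShapleyFolkman.toReal z‖
          ≤ min (ShapleyFolkman.alpha n (ShapleyFolkman.halfCeil m))
              (ShapleyFolkman.beta n (ShapleyFolkman.halfCeil m)) ∧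
        (ShapleyFolkman.IsIntegral x →
          ‖x - ShapleyFolkman.toReal z‖
            ≤ min (⌊ShapleyFolkman.alpha n (ShapleyFolkman.halfCeil m)⌋ : ℝ)
                (⌊ShapleyFolkman.beta n (ShapleyFolkman.halfCeil m)⌋ : ℝ))) := by
  obtain ⟨A, B, hA, hB, hAB⟩ := ShapleyFolkman.exists_pairs S hS
  have hk : 0 < ShapleyFolkman.halfCeil m := by
    rw [ShapleyFolkman.halfCeil_eq]
    omega
  obtain rfl := hW.trans hAB
  obtain ⟨⟨z, hz, hzn⟩, ⟨w, hw, hwn⟩⟩ := ShapleyFolkman.exists_near hn hk A B hA hB hx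
  have hwn' := (ShapleyFolkman.norm_le_norm2 _).trans hwn
  refine ⟨⟨⟨z, hz, hzn, ShapleyFolkman.norm_sub_le_floor hzn⟩, ShapleyFolkman.floor_alpha hn hk⟩,
    ⟨w, hw, hwn, ShapleyFolkman.norm_sub_le_floor hwn'⟩, ?_⟩
  -- The point attaining the smaller bound meets both, since the Euclidean norm dominates the
  -- maximum norm and floors are monotone.
  rcases le_total (ShapleyFolkman.alpha n (ShapleyFolkman.halfCeil m))
    (ShapleyFolkman.beta n (ShapleyFolkman.halfCeil m)) with h | h
  · refine ⟨z, hz, le_min hzn (hzn.trans h), fun hi => ?_⟩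
    have := ShapleyFolkman.norm_sub_le_floor hzn hi
    exact le_min this (this.trans (Int.cast_le.2 (Int.floor_mono h)))
  · refine ⟨w, hw, le_min (hwn'.trans h) hwn', fun hi => ?_⟩
    have := ShapleyFolkman.norm_sub_le_floor hwn' hi
    exact le_min (this.trans (Int.cast_le.2 (Int.floor_mono h))) this
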